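/- **Setting.** Let $X$ be a real Banach space, $U,Y$ real Hilbert spaces, and let $X\hookrightarrow Y$ be embedded continuously and densely. Let $\mathcal A:D(\mathcal A)\subset X\to X$ generate a strongly continuous semigroup $(\mathcal T_{\mathcal A}(t))_{t\ge0}$ on $X$, let $\mathcal B\in L(U,X)$, and let $f:X\times U\to X$ and $J:X\times U\to\mathbb R$ be Fréchet differentiable with partial derivatives $f_x,f_u,J_x,J_u$. Fix a sign $\sigma\in\{1,-1\}$. Let $(\bar x,\bar u)\in D(\mathcal A)\times U$ and $\bar\lambda\in Y$ satisfy the steady state optimality system $$0=-(\mathcal A+f_x(\bar x,\bar u))^*\bar\lambda+\sigma J_x(\bar x,\bar u),\quad 0=(\mathcal B+f_u(\bar x,\bar u))^*\bar\lambda+J_u(\bar x,\bar u),\quad 0=\mathcal A\bar x+\mathcal B\bar u+f(\bar x,\bar u),$$ the first equation being understood in $X^*$ (with $Y\simeq Y^*\hookrightarrow X^*$). Put $A=\mathcal A+f_x(\bar x,\bar u)$, $B=\mathcal B+f_u(\bar x,\bar u)\in L(U,Y)$; let $A^*$ be the adjoint of $A$ in $Y$ (i.e. $y\in D(A^*)$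 and $A^*y=z$ iff $y,z\in Y$ and $\langle z,v\rangle_Y=\langle y,Av\rangle_Y$ for all $v\in D(\mathcal A)$) and $B^*:Y\to U$ the adjoint of $B$. Assume that $A^*$ generates a strongly continuous semigroup $(\mathcal T^*(t))_{t\ge0}$ on $Y$. Let $x_0\in X$. For every $T>0$ let $x=x_T\in C([0,T];X)$, $u=u_T\in L_2(0,T;U)$, $\lambda=\lambda_T\in C([0,T];Y)$ satisfy the optimality system $$\dot x=\mathcal Ax+\mathcal Bu+f(x,u),\quad x(0)=x_0,$$ $$\dot\lambda=-(\mathcal A+f_x(x,u))^*\lambda+\sigma J_x(x,u),\quad\lambda(T)=0,$$ $$0=(\mathcal B+f_u(x(t),u(t)))^*\lambda(t)+J_u(x(t),u(t))\quad\text{for a.e. }t\in[0,T].$$ Here the state equation is meant in the mild sense: $\mathcal Bu+f(x,u)$ is Bochner integrable on $[0,T]$ with values in $X$, and $$x(t)=\mathcal T_{\mathcal A}(t)x_0+\int_0^t\mathcal T_{\mathcal A}(t-s)\big(\mathcal Bu(s)+f(x(s),u(s))\big)\,ds,\qquad t\in[0,T].$$ With $r_{f_\star}(t)=f_\star(x(t),u(t))-f_\star(\bar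 x,\bar u)$, $r_{J_\star}(t)=J_\star(x(t),u(t))-J_\star(\bar x,\bar u)$ for $\star\in\{x,u\}$ and $\delta\lambda=\lambda-\bar\lambda$, the adjoint equation is likewise meant in the mild sense: $r_{f_x}(s)^*\lambda(s)-\sigma r_{J_x}(s)\in X^*$ belongs to $Y$ for a.e. $s\in[0,T]$, is integrable on $[0,T]$ with values in $Y$, and $$\delta\lambda(t)=\mathcal T^*(T-t)\delta\lambda(T)+\int_t^T\mathcal T^*(s-t)\big(r_{f_x}(s)^*\lambda(s)-\sigma r_{J_x}(s)\big)\,ds,\qquad t\in[0,T].$$ **Turnpike intervals.** Call $(t_1,t_2)$ *admissible* if $t_1,t_2:[0,\infty)\to[0,\infty)$ are strictly increasing, $0\le t_1(T)\le t_2(T)\le T$, and $T\mapsto t_2(T)-t_1(T)$ is strictly increasing and unbounded. **Theorem.** Assume: 1. (Interval turnpike for state and control.) There is an admissible pair $(t_1,t_2)$ such that for every $\varepsilon>0$ there is $T_0>0$ with $\|x_T(t)-\bar x\|_X+\|u_T(t)-\bar u\|_U\le\varepsilon$ for all $T\ge T_0$ and $t\in[t_1(T),t_2(T)]$. 2. (Continuity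 of the remainders.) $Z$ is a normed space continuously embedded in $Y$ (for example $Z=Y$ or $Z=X$), and the maps $(x,u)\mapsto (f_x(x,u)-f_x(\bar x,\bar u))^*\in L(Z,Y)$, $(x,u)\mapsto J_x(x,u)-J_x(\bar x,\bar u)\in Y$, $(x,u)\mapsto f_u(x,u)-f_u(\bar x,\bar u)\in L(U,Y)$, $(x,u)\mapsto J_u(x,u)-J_u(\bar x,\bar u)\in U^*\simeq U$ are well defined and continuous on $X\times U$. 3. (Bounded adjoints.) $\bar\lambda\in Z$ and $\sup_{T>0}\sup_{t\in[t_1(T),t_2(T)]}\|\lambda_T(t)-\bar\lambda\|_Z<\infty$. 4. (Spectrum decomposition.) In the complexification of $Y$, the set $\sigma^+(A^*)=\sigma(A^*)\cap\{\operatorname{Re}s\ge0\}$ is bounded, and there is a rectifiable simple closed curve $\Gamma$ with $\sigma^+(A^*)$ in its interior and $\sigma(A^*)\setminus\sigma^+(A^*)$ in its exterior; with the spectral projection $P=\frac1{2\pi i}\int_\Gamma(sI-A^*)^{-1}ds$ ($\Gamma$ traversed once in the positive direction), the unstable subspace $Y_u=\operatorname{ran}P$ is finite-dimensional and the restriction of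 $A^*$ to the stable subspace $Y_s=\operatorname{ran}(I-P)$ generates an exponentially stable strongly continuous semigroup. 5. $B^*$ has finite rank. 6. $(A^*,B^*)$ is exponentially detectable: there is $L\in L(U,Y)$ such that $A^*+LB^*$ (with domain $D(A^*)$) generates an exponentially stable strongly continuous semigroup on $Y$. Then the adjoint $\lambda$ has the interval turnpike property at $\bar\lambda$: there is an admissible pair $(s_1,s_2)$ such that for every $\varepsilon>0$ there is $T_0>0$ with $\|\lambda_T(t)-\bar\lambda\|_Y\le\varepsilon$ for all $T\ge T_0$ and $t\in[s_1(T),s_2(T)]$. -/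

import Mathlib

open MeasureTheory Filter Topology Set
open scoped InnerProductSpace LinearPMap

set_option linter.unusedSectionVars false

noncomputable section

namespace AdjointTurnpike

/-! ### Strongly continuous semigroups and their generators -/

section Semigroups

variable {𝕜 E : Type*} [RCLike 𝕜] [NormedAddCommGroup E] [NormedSpace 𝕜 E]

/-- `(S t)` for `t ≥ 0` is a strongly continuous semigroup of bounded operators on `E`
(the values of `S` at negative times are irrelevant). -/
structure IsC0Semigroup (S : ℝ → E →L[𝕜] E) : Prop where
  zero : S 0 = ContinuousLinearMap.id 𝕜 E
  add : ∀ s t : ℝ, 0 ≤ s → 0 ≤ t → S (s + t) = (S s).comp (S t)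
  tendsto : ∀ y : E, Tendsto (fun t : ℝ => S t y) (𝓝[>] 0) (𝓝 y)

/-- The (in general unbounded) operator `A` is the infinitesimal generator of the strongly
continuous semigroup `S`: one has `y ∈ D(A)` and `A y = z` if and only if
`(S h y - y) / h` tends to `z` as `h ↓ 0`. -/
structure Generates (A : E →ₗ.[𝕜] E) (S : ℝ → E →L[𝕜] E) : Prop where
  semigroup : IsC0Semigroup S
  generator : ∀ y z : E, (y, z) ∈ A.graph ↔
    Tendsto (fun h : ℝ => ((h : 𝕜))⁻¹ • (S h y - y)) (𝓝[>] 0) (𝓝 z)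

/-- Exponential stability `‖S t‖ ≤ M e^{-μ t}` of a semigroup. -/
def ExpStable (S : ℝ → E →L[𝕜] E) : Prop :=
  ∃ M μ : ℝ, 0 < μ ∧ ∀ t : ℝ, 0 ≤ t → ‖S t‖ ≤ M * Real.exp (-μ * t)

/-- The operator `A` generates an exponentially stable strongly continuous semigroup. -/
def GeneratesExpStable (A : E →ₗ.[𝕜] E) : Prop :=
  ∃ S : ℝ → E →L[𝕜] E, Generates A S ∧ ExpStable S

end Semigroups

/-- Exponential detectability of the pair `(A, C)`: some output injection `L` makes
`A + L C`, with domain `D(A)`, the generator of an exponentially stable semigroup. -/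
def ExpDetectable {Y U : Type*} [NormedAddCommGroup Y] [NormedSpace ℝ Y]
    [NormedAddCommGroup U] [NormedSpace ℝ U] (A : Y →ₗ.[ℝ] Y) (C : Y →L[ℝ] U) : Prop :=
  ∃ L : U →L[ℝ] Y, GeneratesExpStable (((L.comp C : Y →L[ℝ] Y) : Y →ₗ[ℝ] Y) +ᵥ A)

/-! ### Complexification of a real Hilbert space -/

/-- The complexification `Y + i Y` of a real Hilbert space `Y`, with
`‖p + i q‖² = ‖p‖² + ‖q‖²`. -/
def Complexification (Y : Type*) : Type _ := WithLp 2 (Y × Y)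

namespace Complexification

variable {Y : Type*} [NormedAddCommGroup Y] [InnerProductSpace ℝ Y]

instance : NormedAddCommGroup (Complexification Y) :=
  inferInstanceAs (NormedAddCommGroup (WithLp 2 (Y × Y)))

/-- Real part of a vector. -/
def re (z : Complexification Y) : Y := WithLp.fst z

/-- Imaginary part of a vector. -/
def im (z : Complexification Y) : Y := WithLp.snd z

/-- The vector `p + i q`. -/
def mk (p q : Y) : Complexification Y := WithLp.toLp 2 (p, q)

@[simp] theorem re_mk (p q : Y) : (mk p q).re = p := rfl
@[simp] theorem im_mk (p q : Y) : (mk p q).im = q := rfl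

@[ext] theorem ext {z w : Complexification Y} (h₁ : z.re = w.re) (h₂ : z.im = w.im) :
    z = w := by
  apply WithLp.ofLp_injective
  exact Prod.ext h₁ h₂

@[simp] theorem re_add (z w : Complexification Y) : (z + w).re = z.re + w.re := rfl
@[simp] theorem im_add (z w : Complexification Y) : (z + w).im = z.im + w.im := rfl
@[simp] theorem re_zero : (0 : Complexification Y).re = 0 := rfl
@[simp] theorem im_zero : (0 : Complexification Y).im = 0 := rfl

instance : SMul ℂ (Complexification Y) :=
  ⟨fun c z => mk (c.re • z.re - c.im • z.im) (c.im • z.re + c.re • z.im)⟩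

@[simp] theorem re_smul (c : ℂ) (z : Complexification Y) :
    (c • z).re = c.re • z.re - c.im • z.im := rfl
@[simp] theorem im_smul (c : ℂ) (z : Complexification Y) :
    (c • z).im = c.im • z.re + c.re • z.im := rfl

instance : Module ℂ (Complexification Y) where
  one_smul z := by ext <;> simp
  mul_smul c d z := by ext <;> simp <;> module
  smul_zero c := by ext <;> simp
  smul_add c z w := by ext <;> simp <;> abel
  add_smul c d z := by ext <;> simp <;> module
  zero_smul z := by ext <;> simp

theorem norm_sq (z : Complexification Y) : ‖z‖ ^ 2 = ‖z.re‖ ^ 2 + ‖z.im‖ ^ 2 :=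
  WithLp.prod_norm_sq_eq_of_L2 (α := Y) (β := Y) z

instance : NormedSpace ℂ (Complexification Y) where
  norm_smul_le c z := by
    refine le_of_eq ((sq_eq_sq₀ (norm_nonneg _) (by positivity)).1 ?_)
    rw [mul_pow, norm_sq, norm_sq, Complex.sq_norm, Complex.normSq_apply, re_smul, im_smul,
      norm_sub_sq_real, norm_add_sq_real, norm_smul, norm_smul, norm_smul, norm_smul,
      real_inner_smul_left, real_inner_smul_left, real_inner_smul_right,
      real_inner_smul_right, mul_pow, mul_pow, mul_pow, mul_pow, Real.norm_eq_abs,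
      Real.norm_eq_abs, sq_abs, sq_abs]
    ring

instance [CompleteSpace Y] : CompleteSpace (Complexification Y) :=
  inferInstanceAs (CompleteSpace (WithLp 2 (Y × Y)))

end Complexification

/-- The complexification `p + i q ↦ A p + i A q` of a real operator `A`, with domain
`D(A) + i D(A)`. -/
def complexify {Y : Type*} [NormedAddCommGroup Y] [InnerProductSpace ℝ Y]
    (A : Y →ₗ.[ℝ] Y) : Complexification Y →ₗ.[ℂ] Complexification Y where
  domain :=
    { carrier := {z | z.re ∈ A.domain ∧ z.im ∈ A.domain}
      add_mem' := fun hz hw => ⟨A.domain.add_mem hz.1 hw.1, A.domain.add_mem hz.2 hw.2⟩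
      zero_mem' := ⟨A.domain.zero_mem, A.domain.zero_mem⟩
      smul_mem' := fun c _ hz =>
        ⟨A.domain.sub_mem (A.domain.smul_mem c.re hz.1) (A.domain.smul_mem c.im hz.2),
          A.domain.add_mem (A.domain.smul_mem c.im hz.1) (A.domain.smul_mem c.re hz.2)⟩ }
  toFun :=
    { toFun := fun z => Complexification.mk (A ⟨z.1.re, z.2.1⟩) (A ⟨z.1.im, z.2.2⟩)
      map_add' := fun z w => by
        ext
        · exact A.map_add ⟨z.1.re, z.2.1⟩ ⟨w.1.re, w.2.1⟩
        · exact A.map_add ⟨z.1.im, z.2.2⟩ ⟨w.1.im, w.2.2⟩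
      map_smul' := fun c z => by
        ext
        · exact (A.map_sub (c.re • ⟨z.1.re, z.2.1⟩) (c.im • ⟨z.1.im, z.2.2⟩)).trans
            (congrArg₂ (· - ·) (A.map_smul _ _) (A.map_smul _ _))
        · exact (A.map_add (c.im • ⟨z.1.re, z.2.1⟩) (c.re • ⟨z.1.im, z.2.2⟩)).trans
            (congrArg₂ (· + ·) (A.map_smul _ _) (A.map_smul _ _)) }

/-! ### Spectrum, spectral projection, spectrum decomposition assumption -/

section Spectrum

variable {E : Type*} [NormedAddCommGroup E] [NormedSpace ℂ E]

/-- `R` is the bounded inverse of `s I - A : D(A) → E`. -/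
def IsResolventAt (A : E →ₗ.[ℂ] E) (s : ℂ) (R : E →L[ℂ] E) : Prop :=
  (∀ y : E, ∃ h : R y ∈ A.domain, s • R y - A ⟨R y, h⟩ = y) ∧
    ∀ x : A.domain, R (s • (x : E) - A x) = x

/-- The spectrum of `A`: all `s` for which `s I - A` has no bounded inverse. -/
def opSpectrum (A : E →ₗ.[ℂ] E) : Set ℂ := {s | ¬ ∃ R : E →L[ℂ] E, IsResolventAt A s R}

open Classical in
/-- The resolvent `(s I - A)⁻¹` (and `0` on the spectrum). -/
def opResolvent (A : E →ₗ.[ℂ] E) (s : ℂ) : E →L[ℂ] E :=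
  if h : ∃ R : E →L[ℂ] E, IsResolventAt A s R then h.choose else 0

/-- `σ⁺(A)`, the spectrum in the closed right half-plane. -/
def spectrumPlus (A : E →ₗ.[ℂ] E) : Set ℂ := {s ∈ opSpectrum A | 0 ≤ s.re}

/-- `σ⁻(A)`, the spectrum in the open left half-plane. -/
def spectrumMinus (A : E →ₗ.[ℂ] E) : Set ℂ := {s ∈ opSpectrum A | s.re < 0}

/-- The contour integral of `F` along the curve `γ : [0, 1] → ℂ`. -/
def contourIntegral (γ : ℝ → ℂ) (F : ℂ → E) : E := ∫ t in (0 : ℝ)..1, deriv γ t • F (γ t)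

/-- The winding number of the closed curve `γ` around `z`. -/
def winding (γ : ℝ → ℂ) (z : ℂ) : ℂ :=
  (2 * Real.pi * Complex.I)⁻¹ * contourIntegral γ (fun ζ => (ζ - z)⁻¹)

/-- The points enclosed by a positively oriented simple closed curve. -/
def curveInterior (γ : ℝ → ℂ) : Set ℂ := {z | z ∉ γ '' Icc 0 1 ∧ winding γ z = 1}

/-- The points outside of a simple closed curve. -/
def curveExterior (γ : ℝ → ℂ) : Set ℂ := {z | z ∉ γ '' Icc 0 1 ∧ winding γ z = 0}

/-- A rectifiable, simple, closed curve traversed once in the positive direction.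
Rectifiable curves are given by Lipschitz parametrizations (as is always possible, e.g. by
arc length); positive orientation means that the winding numbers are `1` inside, `0` outside. -/
structure IsRectifiableJordanCurve (γ : ℝ → ℂ) : Prop where
  rectifiable : ∃ K : NNReal, LipschitzOnWith K γ (Icc 0 1)
  closed : γ 0 = γ 1
  simple : InjOn γ (Ico 0 1)
  positive : ∀ z, z ∉ γ '' Icc 0 1 → z ∈ curveInterior γ ∨ z ∈ curveExterior γ

/-- The spectrum decomposition assumption for `A`, with separating curve `γ`: `σ⁺(A)` is
bounded and lies in the interior of `γ`, while `σ⁻(A)` lies in its exterior. -/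
structure SpectrumDecomposition (A : E →ₗ.[ℂ] E) (γ : ℝ → ℂ) : Prop where
  bounded : Bornology.IsBounded (spectrumPlus A)
  curve : IsRectifiableJordanCurve γ
  plus_subset : spectrumPlus A ⊆ curveInterior γ
  minus_subset : spectrumMinus A ⊆ curveExterior γ

/-- The spectral projection `P = (2πi)⁻¹ ∮_γ (s I - A)⁻¹ ds`. -/
def spectralProjection (A : E →ₗ.[ℂ] E) (γ : ℝ → ℂ) : E →L[ℂ] E :=
  (2 * Real.pi * Complex.I)⁻¹ • contourIntegral γ (opResolvent A)

/-- The unstable subspace `P E`. -/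
def unstableSpace (A : E →ₗ.[ℂ] E) (γ : ℝ → ℂ) : Submodule ℂ E :=
  LinearMap.range (spectralProjection A γ : E →ₗ[ℂ] E)

/-- The stable subspace `(I - P) E`. -/
def stableSpace (A : E →ₗ.[ℂ] E) (γ : ℝ → ℂ) : Submodule ℂ E :=
  LinearMap.range ((ContinuousLinearMap.id ℂ E - spectralProjection A γ : E →L[ℂ] E) :
    E →ₗ[ℂ] E)

/-- The restriction (part) of `A` in the subspace `V`: its graph is `graph(A) ∩ (V × V)`. -/
def restrictTo (A : E →ₗ.[ℂ] E) (V : Submodule ℂ E) : V →ₗ.[ℂ] V :=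
  (A.graph.comap (V.subtype.prodMap V.subtype)).toLinearPMap

end Spectrum

/-- The real operator `A` satisfies the spectrum decomposition assumption (in the
complexified space), its unstable part is finite-dimensional and its stable part generates an
exponentially stable semigroup. -/
def SpectralSplitting {Y : Type*} [NormedAddCommGroup Y] [InnerProductSpace ℝ Y]
    (A : Y →ₗ.[ℝ] Y) : Prop :=
  ∃ γ : ℝ → ℂ, SpectrumDecomposition (complexify A) γ ∧
    FiniteDimensional ℂ (unstableSpace (complexify A) γ) ∧
    GeneratesExpStable (restrictTo (complexify A) (stableSpace (complexify A) γ))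

/-! ### The optimal control problem and its optimality system -/

/-- The data of the optimal control problem with dynamics `x' = 𝓐 x + 𝓑 u + f(x, u)` and
running cost `J(x, u)`, together with the Hilbert space `Y ⊇ X` in which adjoints live. -/
structure ControlProblem (X U Y : Type*) [NormedAddCommGroup X] [NormedSpace ℝ X]
    [NormedAddCommGroup U] [InnerProductSpace ℝ U]
    [NormedAddCommGroup Y] [InnerProductSpace ℝ Y] where
  /-- the linear operator `𝓐` -/
  gen : X →ₗ.[ℝ] X
  /-- the semigroup on `X` generated by `𝓐` -/
  sg : ℝ → X →L[ℝ] X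
  generates : Generates gen sg
  /-- the control operator `𝓑` -/
  ctrl : U →L[ℝ] X
  /-- the nonlinearity -/
  f : X × U → X
  differentiable_f : Differentiable ℝ f
  /-- the running cost -/
  J : X × U → ℝ
  differentiable_J : Differentiable ℝ J
  /-- the continuous dense embedding of `X` into `Y` -/
  emb : X →L[ℝ] Y
  injective_emb : Function.Injective emb
  denseRange_emb : DenseRange emb

namespace ControlProblem

variable {X U Y : Type*} [NormedAddCommGroup X] [NormedSpace ℝ X]
  [NormedAddCommGroup U] [InnerProductSpace ℝ U]
  [NormedAddCommGroup Y] [InnerProductSpace ℝ Y]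
  (P : ControlProblem X U Y)

/-- The partial derivative `f_x`. -/
def fx (p : X × U) : X →L[ℝ] X := (fderiv ℝ P.f p).comp (ContinuousLinearMap.inl ℝ X U)

/-- The partial derivative `f_u`. -/
def fu (p : X × U) : U →L[ℝ] X := (fderiv ℝ P.f p).comp (ContinuousLinearMap.inr ℝ X U)

/-- The partial derivative `J_x`, a functional on `X`. -/
def Jx (p : X × U) : X →L[ℝ] ℝ := (fderiv ℝ P.J p).comp (ContinuousLinearMap.inl ℝ X U)

/-- The partial derivative `J_u`, an element of `U* ≃ U`. -/
def Ju (p : X × U) : U →L[ℝ] ℝ := (fderiv ℝ P.J p).comp (ContinuousLinearMap.inr ℝ X U)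

/-- The operator `𝓐 + f_x(p)` on `X` with domain `D(𝓐)`. -/
def linA (p : X × U) : X →ₗ.[ℝ] X := (P.fx p : X →ₗ[ℝ] X) +ᵥ P.gen

/-- The operator `𝓑 + f_u(p)`, regarded as an operator from `U` to `Y`. -/
def linB (p : X × U) : U →L[ℝ] Y := P.emb.comp (P.ctrl + P.fu p)

/-- An operator on `X`, regarded as an (in general unbounded) operator in `Y ⊇ X`. -/
def inY (A : X →ₗ.[ℝ] X) : Y →ₗ.[ℝ] Y :=
  (A.graph.map ((P.emb : X →ₗ[ℝ] Y).prodMap (P.emb : X →ₗ[ℝ] Y))).toLinearPMap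

variable [CompleteSpace U] [CompleteSpace Y]

/-- The operator `A* = (𝓐 + f_x(p))*` in `Y`. -/
def linAadj (p : X × U) : Y →ₗ.[ℝ] Y := (P.inY (P.linA p))†

/-- The operator `B* = (𝓑 + f_u(p))* : Y → U`. -/
def linBadj (p : X × U) : Y →L[ℝ] U := ContinuousLinearMap.adjoint (P.linB p)

/-- The optimality system of the steady state problem, with multiplier `lamb ∈ Y`:
`0 = -(𝓐 + f_x)* lamb + σ J_x`, `0 = (𝓑 + f_u)* lamb + J_u`, `0 = 𝓐 x + 𝓑 u + f`,
all taken at `p = (x, u)`; the first equation is an equation in the dual of `X`. -/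
structure IsSteadyExtremal (σ : ℝ) (p : X × U) (lamb : Y) : Prop where
  adjoint : ∀ v : P.gen.domain,
    ⟪lamb, P.emb (P.gen v + P.fx p v)⟫_ℝ = σ * P.Jx p v
  stationary : ∀ w : U, ⟪lamb, P.linB p w⟫_ℝ + P.Ju p w = 0
  steady : ∃ h : p.1 ∈ P.gen.domain, P.gen ⟨p.1, h⟩ + P.ctrl p.2 + P.f p = 0

/-- The optimality system on the horizon `[0, T]`, for a state `x ∈ C(0,T;X)`, a control
`u ∈ L₂(0,T;U)` and an adjoint `lam ∈ C(0,T;Y)`: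
`lam' = -(𝓐 + f_x(x,u))* lam + σ J_x(x,u)`, `lam(T) = 0`,
`0 = (𝓑 + f_u(x,u))* lam + J_u(x,u)`, and `x' = 𝓐 x + 𝓑 u + f(x,u)`, `x(0) = x₀`.
The differential equations hold in the mild sense. With the steady state `p̄`, `lamb` and the
semigroup `S` generated by `A* = (𝓐 + f_x(p̄))*` on `Y`, the adjoint equation reads
`δ' = -A* δ - g` for `δ = lam - lamb`, where
`g = (f_x(x,u) - f_x(p̄))* lam - σ (J_x(x,u) - J_x(p̄))` takes its values in `Y`. -/
structure IsExtremal (σ : ℝ) (pbar : X × U) (lamb : Y) (S : ℝ → Y →L[ℝ] Y) (x₀ : X) (T : ℝ)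
    (x : ℝ → X) (u : ℝ → U) (lam : ℝ → Y) : Prop where
  continuous_state : ContinuousOn x (Icc 0 T)
  memLp_control : MemLp u 2 (volume.restrict (Icc 0 T))
  continuous_adjoint : ContinuousOn lam (Icc 0 T)
  initial : x 0 = x₀
  terminal : lam T = 0
  integrable_state : IntervalIntegrable (fun s => P.ctrl (u s) + P.f (x s, u s)) volume 0 T
  state : ∀ t ∈ Icc 0 T, x t =
    P.sg t x₀ + ∫ s in (0 : ℝ)..t, P.sg (t - s) (P.ctrl (u s) + P.f (x s, u s))
  adjoint : ∃ g : ℝ → Y, IntervalIntegrable g volume 0 T ∧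
    (∀ᵐ s ∂(volume.restrict (Icc 0 T)), ∀ v : X, ⟪g s, P.emb v⟫_ℝ =
      ⟪lam s, P.emb (P.fx (x s, u s) v - P.fx pbar v)⟫_ℝ
        - σ * (P.Jx (x s, u s) v - P.Jx pbar v)) ∧
    ∀ t ∈ Icc 0 T, lam t - lamb =
      S (T - t) (lam T - lamb) + ∫ s in t..T, S (s - t) (g s)
  stationary : ∀ᵐ s ∂(volume.restrict (Icc 0 T)), ∀ w : U,
    ⟪lam s, P.linB (x s, u s) w⟫_ℝ + P.Ju (x s, u s) w = 0

/-- Continuity of the superposition operators of the remainder terms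
`r_{f_x}, r_{J_x}, r_{f_u}, r_{J_u}`, where `Z` is a normed space embedded in `Y` by `k`:
`(x, u) ↦ r_{f_x}(x, u)*` is continuous into `L(Z, Y)`, `r_{J_x}` into `Y`,
`r_{f_u}` into `L(U, Y)`, and `r_{J_u}` into `U* ≃ U`. -/
structure ContinuousRemainders {Z : Type*} [NormedAddCommGroup Z] [NormedSpace ℝ Z]
    (k : Z →L[ℝ] Y) (pbar : X × U) : Prop where
  fx : ∃ R : X × U → Z →L[ℝ] Y, Continuous R ∧ ∀ p z v,
    ⟪R p z, P.emb v⟫_ℝ = ⟪k z, P.emb (P.fx p v - P.fx pbar v)⟫_ℝ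
  Jx : ∃ r : X × U → Y, Continuous r ∧ ∀ p v,
    ⟪r p, P.emb v⟫_ℝ = P.Jx p v - P.Jx pbar v
  fu : Continuous fun p : X × U => P.emb.comp (P.fu p - P.fu pbar)
  Ju : Continuous fun p : X × U => P.Ju p - P.Ju pbar

end ControlProblem

/-! ### Interval turnpike -/

/-- The requirements on the end points `t₁(T) ≤ t₂(T)` of the turnpike intervals. -/
structure IsTurnpikeInterval (t₁ t₂ : ℝ → ℝ) : Prop where
  strictMono_left : StrictMonoOn t₁ (Ici 0)
  strictMono_right : StrictMonoOn t₂ (Ici 0)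
  bounds : ∀ T : ℝ, 0 ≤ T → 0 ≤ t₁ T ∧ t₁ T ≤ t₂ T ∧ t₂ T ≤ T
  strictMono_length : StrictMonoOn (fun T => t₂ T - t₁ T) (Ici 0)
  unbounded_length : ¬ BddAbove ((fun T => t₂ T - t₁ T) '' Ici 0)

/-- Interval turnpike property for states and controls on `[t₁(T), t₂(T)]`; `x T` and `u T`
are the state and the control on the horizon `[0, T]`. -/
def StateControlTurnpike {X U : Type*} [NormedAddCommGroup X] [NormedAddCommGroup U]
    (t₁ t₂ : ℝ → ℝ) (x : ℝ → ℝ → X) (u : ℝ → ℝ → U) (pbar : X × U) : Prop :=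
  IsTurnpikeInterval t₁ t₂ ∧ ∀ ε > 0, ∃ T₀ > 0, ∀ T ≥ T₀, ∀ t ∈ Icc (t₁ T) (t₂ T),
    ‖x T t - pbar.1‖ + ‖u T t - pbar.2‖ ≤ ε

/-- Interval turnpike property of the adjoint at the steady state adjoint `lamb`. -/
def AdjointTurnpikeProperty {Y : Type*} [NormedAddCommGroup Y]
    (lam : ℝ → ℝ → Y) (lamb : Y) : Prop :=
  ∃ s₁ s₂ : ℝ → ℝ, IsTurnpikeInterval s₁ s₂ ∧ ∀ ε > 0, ∃ T₀ > 0, ∀ T ≥ T₀,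
    ∀ t ∈ Icc (s₁ T) (s₂ T), ‖lam T t - lamb‖ ≤ ε

end AdjointTurnpike

end

/-! The error `δ = λ - λ̄` solves `δ' = -A*δ - g` backwards in time, but `A*` itself need not be
stable. Detectability repairs this: for `K = LB*` the same equation reads `δ' = -(A* + K)δ - (g -
Kδ)`, and `A* + K` generates a semigroup `V` with `‖V t‖ ≤ M e^{-μt}`. On the turnpike interval the
new source is small. The remainders in `g` vanish at the steady state, are continuous, and act on a
bounded adjoint (`source_small`). Subtracting the two stationarity conditions shows that the output
`B*δ` is also made of remainders (`output_small`).

Starting from `t₂(T)`, where `δ` is only known to be bounded, the variation of constants formula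
leaves an error `M e^{-μ(t₂ - t)}‖δ(t₂)‖` plus a multiple of the size of the source
(`IsBackwardMild.norm_le`). On the left half of the interval `t₂ - t` is at least half its length,
which tends to infinity, so both terms become small.

Since solutions are only mild, the change of generator must be made in the integral equations.
`perturbation_formula` compares the two semigroups, and `IsBackwardMild.perturb` transfers this to
solutions by Fubini on a triangle. -/

namespace AdjointTurnpike

variable {E : Type*} [NormedAddCommGroup E] [NormedSpace ℝ E]

/-! ### Local bounds and joint continuity of strongly continuous semigroups. -/

namespace IsC0Semigroup

variable {S : ℝ → E →L[ℝ] E}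

theorem add_apply (hS : IsC0Semigroup S) {s t : ℝ} (hs : 0 ≤ s) (ht : 0 ≤ t) (y : E) :
    S (s + t) y = S s (S t y) := by
  rw [hS.add s t hs ht]; rfl

theorem zero_apply (hS : IsC0Semigroup S) (y : E) : S 0 y = y := by
  rw [hS.zero]; rfl

theorem tendsto_Ici (hS : IsC0Semigroup S) (y : E) :
    Tendsto (fun t : ℝ => S t y) (𝓝[≥] 0) (𝓝 y) := by
  have h : ContinuousWithinAt (fun t : ℝ => S t y) (Ioi 0) 0 := by
    simpa only [ContinuousWithinAt, hS.zero_apply] using hS.tendsto y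
  simpa only [ContinuousWithinAt, hS.zero_apply] using continuousWithinAt_Ioi_iff_Ici.1 h

/-- A strongly continuous semigroup is bounded near `0`. -/
theorem exists_bound_near_zero [CompleteSpace E] (hS : IsC0Semigroup S) :
    ∃ δ > 0, ∃ C, ∀ t ∈ Icc 0 δ, ‖S t‖ ≤ C := by
  -- Otherwise there are times `t n → 0` with `‖S (t n)‖ > n`, although every orbit converges along
  -- them; this contradicts the uniform boundedness principle.
  by_contra! H
  choose t ht hlarge using fun n : ℕ => H (1 / ((n : ℝ) + 1)) (by positivity) n
  have hlim : Tendsto t atTop (𝓝[≥] 0) :=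
    tendsto_nhdsWithin_iff.2 ⟨squeeze_zero (fun n => (ht n).1) (fun n => (ht n).2)
      tendsto_one_div_add_atTop_nhds_zero_nat, Eventually.of_forall fun n => (ht n).1⟩
  obtain ⟨C, hC⟩ := banach_steinhaus (g := fun n => S (t n)) fun y => by
    obtain ⟨C, hC⟩ := ((hS.tendsto_Ici y).comp hlim).norm.bddAbove_range
    exact ⟨C, fun n => hC ⟨n, rfl⟩⟩
  obtain ⟨n, hn⟩ := exists_nat_gt C
  exact absurd (hC n) (not_le.2 (hn.trans (hlarge n)))

/-- A strongly continuous semigroup is bounded on bounded intervals. -/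
theorem exists_bound [CompleteSpace E] (hS : IsC0Semigroup S) (a : ℝ) :
    ∃ C, 0 ≤ C ∧ ∀ t ∈ Icc 0 a, ‖S t‖ ≤ C := by
  obtain ⟨δ, hδ, C, hC⟩ := hS.exists_bound_near_zero
  have key : ∀ n : ℕ, ∃ C, 0 ≤ C ∧ ∀ t ∈ Icc 0 (n * δ), ‖S t‖ ≤ C := by
    intro n
    induction n with
    | zero =>
      refine ⟨‖S 0‖, norm_nonneg _, fun t ht => ?_⟩
      have : t = 0 := le_antisymm (by simpa using ht.2) ht.1
      rw [this]
    | succ n ih =>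
      obtain ⟨D, hD0, hD⟩ := ih
      have hC0 : 0 ≤ C := (norm_nonneg _).trans (hC 0 ⟨le_rfl, hδ.le⟩)
      refine ⟨C + C * D, by positivity, fun t ht => ?_⟩
      rcases le_total t δ with h | h
      · exact (hC t ⟨ht.1, h⟩).trans (by nlinarith)
      · have h1 : t - δ ∈ Icc 0 (n * δ) := ⟨by linarith, by
          have := ht.2; push_cast at this; linarith⟩
        have h2 := hS.add δ (t - δ) hδ.le h1.1
        rw [add_sub_cancel] at h2
        rw [h2]
        calc _ ≤ ‖S δ‖ * ‖S (t - δ)‖ := ContinuousLinearMap.opNorm_comp_le _ _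
          _ ≤ C * D := mul_le_mul (hC δ ⟨hδ.le, le_rfl⟩) (hD _ h1) (norm_nonneg _) hC0
          _ ≤ C + C * D := by linarith
  obtain ⟨n, hn⟩ := exists_nat_gt (a / δ)
  obtain ⟨D, hD0, hD⟩ := key n
  exact ⟨D, hD0, fun t ht => hD t ⟨ht.1, ht.2.trans ((div_lt_iff₀ hδ).1 hn).le⟩⟩

/-- Joint continuity of a strongly continuous semigroup, extended constantly to `t < 0`. -/
theorem continuous_uncurry [CompleteSpace E] (hS : IsC0Semigroup S) :
    Continuous fun p : ℝ × E => S (max p.1 0) p.2 := by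
  rw [continuous_iff_continuousAt]
  rintro ⟨t, y⟩
  obtain ⟨C, hC0, hC⟩ := hS.exists_bound (max t 0 + 1)
  have hmax : Tendsto (fun p : ℝ × E => max p.1 0) (𝓝 (t, y)) (𝓝 (max t 0)) :=
    (continuous_fst.max continuous_const).tendsto (t, y)
  have habs : Tendsto (fun p : ℝ × E => |max p.1 0 - max t 0|) (𝓝 (t, y)) (𝓝[≥] 0) := by
    refine tendsto_nhdsWithin_iff.2 ⟨?_, Eventually.of_forall fun p => mem_Ici.2 (abs_nonneg _)⟩
    simpa using (hmax.sub_const (max t 0)).abs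
  have hlim : Tendsto (fun p : ℝ × E => C * ‖p.2 - y‖ + C * ‖S |max p.1 0 - max t 0| y - y‖)
      (𝓝 (t, y)) (𝓝 0) := by
    have h1 : Tendsto (fun p : ℝ × E => ‖p.2 - y‖) (𝓝 (t, y)) (𝓝 0) := by
      simpa using (((continuous_snd.tendsto (t, y)).sub_const y).norm)
    have h2 := (((hS.tendsto_Ici y).comp habs).sub_const y).norm
    simpa using (h1.const_mul C).add (h2.const_mul C)
  rw [ContinuousAt, tendsto_iff_norm_sub_tendsto_zero]
  refine squeeze_zero' (Eventually.of_forall fun _ => norm_nonneg _) ?_ hlim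
  filter_upwards [hmax.eventually (eventually_le_nhds (lt_add_one (max t 0)))] with p hp
  set s := max p.1 0
  set r := max t 0
  have hs0 : 0 ≤ s := le_max_right _ _
  have hr0 : 0 ≤ r := le_max_right _ _
  have hsplit : S s p.2 - S r y = S s (p.2 - y) + (S s y - S r y) := by
    rw [map_sub]; abel
  -- Factoring out the semigroup at the earlier time reduces continuity from either side to right
  -- continuity at `0`.
  have hy : ‖S s y - S r y‖ ≤ C * ‖S |s - r| y - y‖ := by
    rcases le_total s r with h | h
    · have h1 : S r y = S s (S (r - s) y) := by
        rw [← hS.add_apply hs0 (sub_nonneg.2 h), add_sub_cancel]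
      rw [abs_sub_comm, abs_of_nonneg (sub_nonneg.2 h), norm_sub_rev, h1, ← map_sub]
      exact (S s).le_of_opNorm_le (hC s ⟨hs0, hp⟩) _
    · have h1 : S s y = S r (S (s - r) y) := by
        rw [← hS.add_apply hr0 (sub_nonneg.2 h), add_sub_cancel]
      rw [abs_of_nonneg (sub_nonneg.2 h), h1, ← map_sub]
      exact (S r).le_of_opNorm_le (hC r ⟨hr0, by linarith⟩) _
  rw [hsplit]
  exact (norm_add_le _ _).trans (add_le_add ((S s).le_of_opNorm_le (hC s ⟨hs0, hp⟩) _) hy)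

/-- Joint continuity gives measurability, and the bound on compact time intervals gives the
dominating function. Truncating the time at `0` makes both available for every `s`. -/
theorem intervalIntegrable_orbit [CompleteSpace E] (hS : IsC0Semigroup S) {g : ℝ → E}
    {a b : ℝ} (t : ℝ) (hg : IntervalIntegrable g volume a b) :
    IntervalIntegrable (fun s => S (max (s - t) 0) (g s)) volume a b := by
  obtain ⟨C, hC0, hC⟩ := hS.exists_bound (max (max a b - t) 0)
  refine (hg.norm.const_mul C).mono_fun ?_ ?_
  · exact hS.continuous_uncurry.comp_aestronglyMeasurable
      ((by fun_prop : Continuous fun s : ℝ => s - t).aestronglyMeasurable.prodMk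
        hg.def'.aestronglyMeasurable)
  · refine (ae_restrict_mem measurableSet_uIoc).mono fun s hs => ?_
    beta_reduce
    rw [Real.norm_of_nonneg (by positivity)]
    refine (S _).le_of_opNorm_le (hC _ ⟨le_max_right _ _, ?_⟩) _
    exact max_le_max (sub_le_sub_right hs.2 t) le_rfl

end IsC0Semigroup

/-! ### Generators and bounded perturbations. -/

namespace Generates

variable {A : E →ₗ.[ℝ] E} {S : ℝ → E →L[ℝ] E}

theorem tendsto_slope (hS : Generates A S) {y z : E} (h : (y, z) ∈ A.graph) :
    Tendsto (fun h : ℝ => h⁻¹ • (S h y - y)) (𝓝[>] 0) (𝓝 z) := by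
  simpa using (hS.generator y z).1 h

/-- `S t` commutes with `S r`, so it maps the difference quotients of `y` to those of `S t y`. -/
theorem apply_mem_graph (hS : Generates A S) {y z : E} (h : (y, z) ∈ A.graph) {t : ℝ}
    (ht : 0 ≤ t) : (S t y, S t z) ∈ A.graph := by
  rw [hS.generator]
  refine (((S t).continuous.tendsto z).comp ((hS.generator y z).1 h)).congr' ?_
  filter_upwards [self_mem_nhdsWithin] with r hr
  have hr0 : 0 ≤ r := (mem_Ioi.1 hr).le
  simp only [Function.comp_apply, map_smul, map_sub, ← hS.semigroup.add_apply ht hr0,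
    ← hS.semigroup.add_apply hr0 ht, add_comm t r]

/-- Applying `S r` shifts the window of integration, so `S r - I` leaves only the two end pieces of
length `r`. Divided by `r` they converge to `S h y - y`. These averages supply the dense set in
`dense_domain`. -/
theorem integral_mem_domain [CompleteSpace E] (hS : Generates A S) (y : E) {h : ℝ}
    (hh : 0 ≤ h) : ∫ s in (0 : ℝ)..h, S (max s 0) y ∈ A.domain := by
  set F : ℝ → E := fun s => S (max s 0) y
  have hF : Continuous F :=
    hS.semigroup.continuous_uncurry.comp (by fun_prop : Continuous fun s : ℝ => (s, y))
  have hgraph : (∫ s in (0 : ℝ)..h, F s, F h - F 0) ∈ A.graph := by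
    rw [hS.generator]
    have hd : ∀ b : ℝ, Tendsto (fun r : ℝ => r⁻¹ • ∫ s in b..b + r, F s) (𝓝[>] 0)
        (𝓝 (F b)) := by
      intro b
      have h1 := (hF.integral_hasStrictDerivAt 0 b).hasDerivAt.tendsto_slope_zero_right
      refine h1.congr fun r => ?_
      rw [intervalIntegral.integral_interval_sub_left (hF.intervalIntegrable _ _)
        (hF.intervalIntegrable _ _)]
    refine ((hd h).sub (hd 0)).congr' ?_
    filter_upwards [self_mem_nhdsWithin] with r hr
    have hr0 : 0 ≤ r := (mem_Ioi.1 hr).le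
    have hshift : S r (∫ s in (0 : ℝ)..h, F s) = ∫ s in r..h + r, F s := by
      rw [← (S r).intervalIntegral_comp_comm (hF.intervalIntegrable _ _)]
      have h2 := intervalIntegral.integral_comp_add_right (a := 0) (b := h) F r
      rw [zero_add] at h2
      rw [← h2]
      refine intervalIntegral.integral_congr fun s hs => ?_
      rw [uIcc_of_le hh] at hs
      simp only [F]
      rw [max_eq_left hs.1, max_eq_left (add_nonneg hs.1 hr0), add_comm,
        hS.semigroup.add_apply hr0 hs.1]
    have hi := fun a b : ℝ => hF.intervalIntegrable (μ := volume) a b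
    have h3 : (∫ s in h..h + r, F s) - ∫ s in (0 : ℝ)..0 + r, F s
        = S r (∫ s in (0 : ℝ)..h, F s) - ∫ s in (0 : ℝ)..h, F s := by
      rw [hshift, zero_add, ← intervalIntegral.integral_add_adjacent_intervals (hi r h)
        (hi h (h + r)), ← intervalIntegral.integral_add_adjacent_intervals (hi 0 r) (hi r h)]
      abel
    rw [← smul_sub, h3]
    simp
  obtain ⟨w, hw, -⟩ := (LinearPMap.mem_graph_iff A).1 hgraph
  simp only at hw
  rw [← hw]
  exact w.2

/-- The generator of a strongly continuous semigroup is densely defined. -/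
theorem dense_domain [CompleteSpace E] (hS : Generates A S) : Dense (A.domain : Set E) := by
  intro y
  have hF : Continuous fun s => S (max s 0) y :=
    hS.semigroup.continuous_uncurry.comp (by fun_prop : Continuous fun s : ℝ => (s, y))
  have h1 := (hF.integral_hasStrictDerivAt 0 0).hasDerivAt.tendsto_slope_zero_right
  simp only [max_self, hS.semigroup.zero_apply, zero_add, intervalIntegral.integral_same,
    sub_zero] at h1
  refine mem_closure_of_tendsto h1 ?_
  filter_upwards [self_mem_nhdsWithin] with r hr
  exact A.domain.smul_mem _ (hS.integral_mem_domain y (mem_Ioi.1 hr).le)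

/-- Variation of constants: the semigroup `V` generated by `K + A`, in terms of the semigroup
`S` generated by `A`. -/
theorem perturbation_formula [CompleteSpace E] (hS : Generates A S) {K : E →L[ℝ] E}
    {V : ℝ → E →L[ℝ] E} (hV : Generates ((K : E →ₗ[ℝ] E) +ᵥ A) V) {t : ℝ} (ht : 0 ≤ t)
    (y : E) :
    V t y - S t y = ∫ s in (0 : ℝ)..t, V (max (t - s) 0) (K (S (max s 0) y)) := by
  have hVc := hV.semigroup.continuous_uncurry
  have hSc := hS.semigroup.continuous_uncurry
  have hint : Continuous fun p : E × ℝ => V (max (t - p.2) 0) (K (S (max p.2 0) p.1)) :=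
    hVc.comp ((by fun_prop : Continuous fun p : E × ℝ => t - p.2).prodMk
      (K.continuous.comp (hSc.comp (by fun_prop : Continuous fun p : E × ℝ => (p.2, p.1)))))
  -- Both sides are continuous in `y`, so it suffices to treat the dense domain, where orbits can be
  -- differentiated.
  refine Dense.induction (P := fun y => V t y - S t y =
    ∫ s in (0 : ℝ)..t, V (max (t - s) 0) (K (S (max s 0) y))) hS.dense_domain ?_ ?_ y
  · intro y hy
    -- The path `φ` runs from `V t y` to `S t y`. Its right derivative is `V (t - s) (A - (K + A)) S
    -- s y`, in which the unbounded parts cancel. Right derivatives suffice for the fundamental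
    -- theorem, and the generator provides exactly these.
    set φ : ℝ → E := fun s => V (max (t - s) 0) (S (max s 0) y)
    have hφ : Continuous φ :=
      hVc.comp ((by fun_prop : Continuous fun s : ℝ => t - s).prodMk
        (hSc.comp (by fun_prop : Continuous fun s : ℝ => (s, y))))
    have hf' : Continuous fun s => -V (max (t - s) 0) (K (S (max s 0) y)) :=
      (hint.comp (by fun_prop : Continuous fun s : ℝ => (y, s))).neg
    have key := intervalIntegral.integral_eq_sub_of_hasDeriv_right (a := 0) (b := t)
      hφ.continuousOn (fun s hs => ?_) (hf'.intervalIntegrable 0 t)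
    · rw [intervalIntegral.integral_neg, neg_eq_iff_eq_neg] at key
      rw [key]
      simp [φ, max_eq_left ht, hS.semigroup.zero_apply, hV.semigroup.zero_apply]
    · rw [min_eq_left ht, max_eq_right ht] at hs
      rw [hasDerivWithinAt_iff_tendsto_slope' self_notMem_Ioi]
      set w := S s y
      obtain ⟨z, hz⟩ : ∃ z, (w, z) ∈ A.graph :=
        ⟨_, hS.apply_mem_graph (A.mem_graph ⟨y, hy⟩) hs.1.le⟩
      have hz' : (w, K w + z) ∈ ((K : E →ₗ[ℝ] E) +ᵥ A).graph := by
        obtain ⟨v, hv, hvz⟩ := (LinearPMap.mem_graph_iff A).1 hz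
        simp only at hv hvz
        exact (LinearPMap.mem_graph_iff _).2 ⟨⟨v, v.2⟩, hv, by
          rw [LinearPMap.vadd_apply]
          exact congrArg₂ (· + ·) (congrArg K hv) hvz⟩
      have hsub : Tendsto (fun r : ℝ => r - s) (𝓝[>] s) (𝓝[>] 0) := by
        refine tendsto_nhdsWithin_iff.2 ⟨?_, ?_⟩
        · exact ((by fun_prop : Continuous fun r : ℝ => r - s).tendsto' s 0 (sub_self s)).mono_left
            nhdsWithin_le_nhds
        · filter_upwards [self_mem_nhdsWithin] with r hr using sub_pos.2 (mem_Ioi.1 hr)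
      have hdiff := ((hS.tendsto_slope hz).sub (hV.tendsto_slope hz')).comp hsub
      have htime : Tendsto (fun r : ℝ => t - r) (𝓝[>] s) (𝓝 (t - s)) :=
        ((by fun_prop : Continuous fun r : ℝ => t - r).tendsto s).mono_left nhdsWithin_le_nhds
      -- The slope of `φ` is `V (t - r)` applied to the difference of the quotients of `S` and `V`
      -- at `w`. Time and argument move together, hence the use of joint continuity.
      have hlim := (hVc.tendsto (t - s, z - (K w + z))).comp (htime.prodMk_nhds hdiff)
      have heq : V (max (t - s) 0) (z - (K w + z))
          = -V (max (t - s) 0) (K (S (max s 0) y)) := by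
        rw [max_eq_left hs.1.le, ← map_neg]; congr 1; abel
      simp only [heq] at hlim
      refine hlim.congr' ?_
      filter_upwards [Ioo_mem_nhdsGT hs.2] with r hr
      have hr0 : 0 ≤ r := hs.1.le.trans hr.1.le
      have hrs : 0 ≤ r - s := sub_nonneg.2 hr.1.le
      have htr : 0 ≤ t - r := sub_nonneg.2 hr.2.le
      have h1 : S r y = S (r - s) w := by
        rw [← hS.semigroup.add_apply hrs hs.1.le, sub_add_cancel]
      have h2 : V (t - s) w = V (t - r) (V (r - s) w) := by
        rw [← hV.semigroup.add_apply htr hrs]; congr 2; ring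
      simp only [Function.comp_apply, slope_def_module, φ, max_eq_left htr, max_eq_left hr0,
        max_eq_left hs.1.le, max_eq_left (sub_nonneg.2 hs.2.le)]
      rw [h1, show S s y = w from rfl, h2, ← map_sub, ← map_smul, ← smul_sub]
      congr 2; abel
  · exact isClosed_eq (((V t).continuous).sub (S t).continuous)
      (intervalIntegral.continuous_parametric_intervalIntegral_of_continuous' hint 0 t)

end Generates

end AdjointTurnpike

/-! ### Backward mild solutions: restriction, change of generator, decay estimate. -/

namespace AdjointTurnpike

variable {E : Type*} [NormedAddCommGroup E] [NormedSpace ℝ E]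

/-- Interchange of the order of integration over a triangle. -/
theorem integral_integral_swap_triangle {a b : ℝ} (hab : a ≤ b) {G : ℝ → ℝ → E}
    (hG : Integrable (Function.uncurry G)
      ((volume.restrict (Ioc a b)).prod (volume.restrict (Ioc a b)))) :
    ∫ s in a..b, ∫ p in s..b, G s p = ∫ p in a..b, ∫ s in a..p, G s p := by
  have hm : MeasurableSet {q : ℝ × ℝ | q.1 < q.2} := measurableSet_lt measurable_fst measurable_snd
  -- Extending `G` by zero off `s < p` turns the triangle into a square, where Fubini applies.
  have hswap := integral_integral_swap
    (f := fun s p => {q : ℝ × ℝ | q.1 < q.2}.indicator (Function.uncurry G) (s, p))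
    (hG.indicator hm)
  rw [intervalIntegral.integral_of_le hab, intervalIntegral.integral_of_le hab]
  refine Eq.trans ?_ (hswap.trans ?_)
  · refine setIntegral_congr_fun measurableSet_Ioc fun s hs => ?_
    have h1 : ∀ p, {q : ℝ × ℝ | q.1 < q.2}.indicator (Function.uncurry G) (s, p)
        = (Ioi s).indicator (G s) p := fun p => by
      simp only [indicator, mem_ofPred_eq, mem_Ioi, Function.uncurry]
    simp only [h1]
    rw [intervalIntegral.integral_of_le hs.2, setIntegral_indicator measurableSet_Ioi]
    congr 2
    ext p
    exact ⟨fun h => ⟨⟨hs.1.trans h.1, h.2⟩, h.1⟩, fun h => ⟨h.2, h.1.2⟩⟩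
  · refine setIntegral_congr_fun measurableSet_Ioc fun p hp => ?_
    have h1 : ∀ s, {q : ℝ × ℝ | q.1 < q.2}.indicator (Function.uncurry G) (s, p)
        = (Iio p).indicator (fun s => G s p) s := fun s => by
      simp only [indicator, mem_ofPred_eq, mem_Iio, Function.uncurry]
    simp only [h1]
    rw [intervalIntegral.integral_of_le hp.1.le, setIntegral_indicator measurableSet_Iio,
      integral_Ioc_eq_integral_Ioo]
    congr 2
    ext s
    exact ⟨fun h => ⟨h.1.1, h.2⟩, fun h => ⟨⟨h.1, h.2.le.trans hp.2⟩, h.2⟩⟩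

/-- `δ` is the mild solution on `[0, T]` of the backward equation `δ' = -A δ - g`, where `A`
generates the semigroup `S`. -/
def IsBackwardMild (S : ℝ → E →L[ℝ] E) (T : ℝ) (δ g : ℝ → E) : Prop :=
  ∀ t ∈ Icc 0 T, δ t = S (T - t) (δ T) + ∫ s in t..T, S (s - t) (g s)

theorem integral_orbit_congr (S : ℝ → E →L[ℝ] E) (g : ℝ → E) {t T : ℝ}
    (h : t ≤ T) :
    ∫ s in t..T, S (s - t) (g s) = ∫ s in t..T, S (max (s - t) 0) (g s) := by
  refine intervalIntegral.integral_congr fun s hs => ?_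
  rw [uIcc_of_le h] at hs
  rw [max_eq_left (sub_nonneg.2 hs.1)]

/-- Restriction of a backward mild solution to a shorter horizon. -/
theorem IsBackwardMild.restrict [CompleteSpace E] {S : ℝ → E →L[ℝ] E} (hS : IsC0Semigroup S)
    {T : ℝ} {δ g : ℝ → E} (hg : IntervalIntegrable g volume 0 T) (h : IsBackwardMild S T δ g)
    {τ : ℝ} (hτ : τ ∈ Icc 0 T) : IsBackwardMild S τ δ g := by
  intro t ht
  have hi : ∀ r a b : ℝ, a ∈ Icc 0 T → b ∈ Icc 0 T →
      IntervalIntegrable (fun s => S (max (s - r) 0) (g s)) volume a b := fun r a b ha hb =>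
    hS.intervalIntegrable_orbit r (hg.mono_set (by
      rw [uIcc_of_le (hτ.1.trans hτ.2)]; exact uIcc_subset_Icc ha hb))
  have ht' : t ∈ Icc 0 T := ⟨ht.1, ht.2.trans hτ.2⟩
  have hT : T ∈ Icc 0 T := ⟨hτ.1.trans hτ.2, le_rfl⟩
  -- The integral is split at `τ`; the piece beyond `τ` and the terminal term both contain the
  -- factor `S (τ - t)`, which reassembles `δ τ`.
  rw [h t ht', h τ hτ, integral_orbit_congr S g ht'.2,
    integral_orbit_congr S g ht.2, integral_orbit_congr S g hτ.2,
    ← intervalIntegral.integral_add_adjacent_intervals (hi t t τ ht' hτ) (hi t τ T hτ hT),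
    map_add, ← hS.add_apply (sub_nonneg.2 ht.2) (sub_nonneg.2 hτ.2),
    ← (S (τ - t)).intervalIntegral_comp_comm (hi τ τ T hτ hT)]
  have h1 : ∫ s in τ..T, S (τ - t) (S (max (s - τ) 0) (g s))
      = ∫ s in τ..T, S (max (s - t) 0) (g s) := by
    refine intervalIntegral.integral_congr fun s hs => ?_
    rw [uIcc_of_le hτ.2] at hs
    rw [max_eq_left (sub_nonneg.2 hs.1), max_eq_left (sub_nonneg.2 (ht.2.trans hs.1)),
      ← hS.add_apply (sub_nonneg.2 ht.2) (sub_nonneg.2 hs.1)]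
    congr 2; ring
  rw [h1, show τ - t + (T - τ) = T - t by ring]
  abel

/-- A mild solution with respect to the semigroup generated by `A` is a mild solution with
respect to the semigroup generated by `K + A`, for the source term `g - K δ`. -/
theorem IsBackwardMild.perturb [CompleteSpace E] {A : E →ₗ.[ℝ] E} {S V : ℝ → E →L[ℝ] E}
    {K : E →L[ℝ] E} (hS : Generates A S) (hV : Generates ((K : E →ₗ[ℝ] E) +ᵥ A) V)
    {T : ℝ} {δ g : ℝ → E} (hδ : ContinuousOn δ (Icc 0 T))
    (hg : IntervalIntegrable g volume 0 T) (h : IsBackwardMild S T δ g) :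
    IsBackwardMild V T δ (fun s => g s - K (δ s)) := by
  intro t ht
  have hVc := hV.semigroup.continuous_uncurry
  have hSc := hS.semigroup.continuous_uncurry
  have htT : t ≤ T := ht.2
  have hgt : IntervalIntegrable g volume t T := hg.mono_set (by
    rw [uIcc_of_le htT, uIcc_of_le (ht.1.trans htT)]; exact Icc_subset_Icc_left ht.1)
  have hKδ : IntervalIntegrable (fun s => K (δ s)) volume t T := by
    refine (K.continuous.comp_continuousOn (hδ.mono ?_)).intervalIntegrable
    rw [uIcc_of_le htT]; exact Icc_subset_Icc_left ht.1
  have hVKδ := hV.semigroup.intervalIntegrable_orbit t hKδ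
  -- The perturbation formula with time reflected, so that `V` carries the part from `t` to `s` and
  -- `S` the part from `s` to `p`.
  have hpert : ∀ p ∈ Icc t T, ∀ y : E,
      V (p - t) y - S (p - t) y
        = ∫ s in t..p, V (max (s - t) 0) (K (S (max (p - s) 0) y)) := by
    intro p hp y
    rw [hS.perturbation_formula hV (sub_nonneg.2 hp.1)]
    have h2 := intervalIntegral.integral_comp_sub_left (a := t) (b := p)
      (fun s => V (max (p - t - s) 0) (K (S (max s 0) y))) p
    rw [sub_self] at h2
    rw [← h2]
    refine intervalIntegral.integral_congr fun s _ => ?_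
    rw [show p - t - (p - s) = s - t by ring]
  set G : ℝ → ℝ → E := fun s p => V (max (s - t) 0) (K (S (max (p - s) 0) (g p)))
  have hGint : Integrable (Function.uncurry G)
      ((volume.restrict (Ioc t T)).prod (volume.restrict (Ioc t T))) := by
    obtain ⟨C, hC0, hC⟩ := hV.semigroup.exists_bound (T - t)
    obtain ⟨D, hD0, hD⟩ := hS.semigroup.exists_bound (T - t)
    have hgI : Integrable g (volume.restrict (Ioc t T)) :=
      (intervalIntegrable_iff_integrableOn_Ioc_of_le htT).1 hgt
    have hgp : Integrable (fun q : ℝ × ℝ => g q.2)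
        ((volume.restrict (Ioc t T)).prod (volume.restrict (Ioc t T))) :=
      hgI.comp_snd (volume.restrict (Ioc t T))
    refine (hgp.norm.const_mul (C * (‖K‖ * D))).mono' ?_ ?_
    · exact hVc.comp_aestronglyMeasurable
        ((by fun_prop : Continuous fun q : ℝ × ℝ => q.1 - t).aestronglyMeasurable.prodMk
          (K.continuous.comp_aestronglyMeasurable (hSc.comp_aestronglyMeasurable
            ((by fun_prop : Continuous fun q : ℝ × ℝ => q.2 - q.1).aestronglyMeasurable.prodMk
              hgp.aestronglyMeasurable))))
    · rw [Measure.prod_restrict]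
      refine (ae_restrict_mem (measurableSet_Ioc.prod measurableSet_Ioc)).mono fun q hq => ?_
      have hVq : ‖V (max (q.1 - t) 0)‖ ≤ C := hC _ ⟨le_max_right _ _,
        max_le (sub_le_sub_right hq.1.2 t) (sub_nonneg.2 htT)⟩
      have hSq : ‖S (max (q.2 - q.1) 0)‖ ≤ D := hD _ ⟨le_max_right _ _,
        max_le (sub_le_sub hq.2.2 hq.1.1.le) (sub_nonneg.2 htT)⟩
      calc ‖V (max (q.1 - t) 0) (K (S (max (q.2 - q.1) 0) (g q.2)))‖
          ≤ C * (‖K‖ * (D * ‖g q.2‖)) := by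
            refine (V _).le_of_opNorm_le_of_le hVq (K.le_of_opNorm_le_of_le le_rfl ?_)
            exact (S _).le_of_opNorm_le hSq _
        _ = C * (‖K‖ * D) * ‖g q.2‖ := by ring
  have hVKS : IntervalIntegrable
      (fun s => V (max (s - t) 0) (K (S (max (T - s) 0) (δ T)))) volume t T :=
    (hVc.comp ((by fun_prop : Continuous fun s : ℝ => s - t).prodMk
      (K.continuous.comp (hSc.comp
        (by fun_prop : Continuous fun s : ℝ => (T - s, δ T)))))).intervalIntegrable _ _
  -- The mild formula for `δ s` is inserted into the feedback term, which produces the double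
  -- integral over `t ≤ s ≤ p ≤ T`.
  have hinner : ∀ s ∈ Icc t T, V (max (s - t) 0) (K (δ s))
      = V (max (s - t) 0) (K (S (max (T - s) 0) (δ T))) + ∫ p in s..T, G s p := by
    intro s hs
    have hgs : IntervalIntegrable g volume s T := hgt.mono_set (by
      rw [uIcc_of_le htT, uIcc_of_le hs.2]; exact Icc_subset_Icc_left hs.1)
    have := ((V (max (s - t) 0)).comp K).intervalIntegral_comp_comm
      (hS.semigroup.intervalIntegrable_orbit s hgs)
    rw [h s ⟨ht.1.trans hs.1, hs.2⟩, integral_orbit_congr S g hs.2, map_add,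
      map_add, max_eq_left (sub_nonneg.2 hs.2)]
    exact congrArg₂ (· + ·) rfl this.symm
  have hdouble : IntervalIntegrable (fun s => ∫ p in s..T, G s p) volume t T := by
    refine (hVKδ.sub hVKS).congr fun s hs => ?_
    rw [uIoc_of_le htT] at hs
    rw [hinner s (Ioc_subset_Icc_self hs), add_sub_cancel_left]
  -- After the swap, the inner integral over `s` is `hpert` applied to `g p`. The feedback term is
  -- therefore exactly the change caused by replacing `S` with `V` in the terminal and source terms.
  have hKint : ∫ s in t..T, V (max (s - t) 0) (K (δ s))
      = (V (T - t) (δ T) - S (T - t) (δ T))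
        + ((∫ s in t..T, V (max (s - t) 0) (g s)) - ∫ s in t..T, S (max (s - t) 0) (g s)) := by
    rw [hpert T ⟨htT, le_rfl⟩, intervalIntegral.integral_congr (g := fun s =>
      V (max (s - t) 0) (K (S (max (T - s) 0) (δ T))) + ∫ p in s..T, G s p)
      (fun s hs => hinner s (by rwa [uIcc_of_le htT] at hs)),
      intervalIntegral.integral_add hVKS hdouble,
      integral_integral_swap_triangle htT hGint,
      ← intervalIntegral.integral_sub (hV.semigroup.intervalIntegrable_orbit t hgt)
        (hS.semigroup.intervalIntegrable_orbit t hgt)]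
    congr 1
    refine intervalIntegral.integral_congr fun p hp => ?_
    rw [uIcc_of_le htT] at hp
    rw [max_eq_left (sub_nonneg.2 hp.1), hpert p hp]
  rw [h t ht, integral_orbit_congr S g htT,
    integral_orbit_congr V _ htT]
  simp only [map_sub]
  rw [intervalIntegral.integral_sub (hV.semigroup.intervalIntegrable_orbit t hgt) hVKδ, hKint]
  abel

/-- A backward mild solution for an exponentially stable semigroup, with a source term bounded
by `η`. -/
theorem IsBackwardMild.norm_le {V : ℝ → E →L[ℝ] E} {M μ : ℝ}
    (hμ : 0 < μ) (hV : ∀ t : ℝ, 0 ≤ t → ‖V t‖ ≤ M * Real.exp (-μ * t)) {T : ℝ}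
    {δ g : ℝ → E} (h : IsBackwardMild V T δ g) {t η : ℝ} (ht : t ∈ Icc 0 T)
    (hη : ∀ᵐ s, s ∈ Ioc t T → ‖g s‖ ≤ η) (hη0 : 0 ≤ η) :
    ‖δ t‖ ≤ M * Real.exp (-μ * (T - t)) * ‖δ T‖ + M * η / μ := by
  have hM : 0 ≤ M := by simpa using (norm_nonneg _).trans (hV 0 le_rfl)
  rw [h t ht]
  refine (norm_add_le _ _).trans (add_le_add
    ((V _).le_of_opNorm_le (hV _ (sub_nonneg.2 ht.2)) _) ?_)
  have hcont : Continuous fun s : ℝ => M * η * Real.exp (-μ * (s - t)) := by fun_prop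
  refine (intervalIntegral.norm_integral_le_of_norm_le ht.2
    (g := fun s => M * η * Real.exp (-μ * (s - t))) ?_ (hcont.intervalIntegrable _ _)).trans ?_
  · filter_upwards [hη] with s hs hst
    calc ‖V (s - t) (g s)‖ ≤ M * Real.exp (-μ * (s - t)) * η :=
          (V _).le_of_opNorm_le_of_le (hV _ (sub_nonneg.2 hst.1.le)) (hs hst)
      _ = M * η * Real.exp (-μ * (s - t)) := by ring
  -- The exponential is integrated explicitly; discarding its nonpositive contribution at `T` gives
  -- a bound independent of the horizon.
  · have hd : ∀ s ∈ uIcc t T, HasDerivAt (fun s => -(M * η / μ) * Real.exp (-μ * (s - t)))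
        (M * η * Real.exp (-μ * (s - t))) s := fun s _ => by
      have h1 : HasDerivAt (fun s => -μ * (s - t)) (-μ) s := by
        simpa using ((hasDerivAt_id s).sub_const t).const_mul (-μ)
      refine (h1.exp.const_mul (-(M * η / μ))).congr_deriv ?_
      field_simp
    rw [intervalIntegral.integral_eq_sub_of_hasDerivAt hd (hcont.intervalIntegrable _ _)]
    have h2 : 0 ≤ M * η / μ * Real.exp (-μ * (T - t)) := by positivity
    simp only [sub_self, mul_zero, Real.exp_zero]
    linarith

end AdjointTurnpike

/-! ### Turnpike intervals and smallness of the remainders. -/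

namespace AdjointTurnpike

namespace IsTurnpikeInterval

variable {t₁ t₂ : ℝ → ℝ}

/-- The left half of a turnpike interval. -/
theorem left_half (h : IsTurnpikeInterval t₁ t₂) :
    IsTurnpikeInterval t₁ (fun T => (t₁ T + t₂ T) / 2) where
  strictMono_left := h.strictMono_left
  strictMono_right a ha b hb hab := by
    have h1 := h.strictMono_left ha hb hab
    have h2 := h.strictMono_right ha hb hab
    beta_reduce
    linarith
  bounds T hT := by
    obtain ⟨h1, h2, h3⟩ := h.bounds T hT
    exact ⟨h1, by linarith, by linarith⟩
  strictMono_length a ha b hb hab := by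
    have h1 := h.strictMono_length ha hb hab
    beta_reduce at h1 ⊢
    linarith
  unbounded_length := by
    rintro ⟨C, hC⟩
    refine h.unbounded_length ⟨2 * C, ?_⟩
    rintro _ ⟨T, hT, rfl⟩
    have h1 := hC ⟨T, hT, rfl⟩
    beta_reduce at h1 ⊢
    linarith

theorem tendsto_length (h : IsTurnpikeInterval t₁ t₂) :
    Tendsto (fun T => t₂ T - t₁ T) atTop atTop := by
  refine tendsto_atTop.2 fun C => ?_
  obtain ⟨_, ⟨T, hT, rfl⟩, hC⟩ := not_bddAbove_iff.1 h.unbounded_length C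
  filter_upwards [eventually_ge_atTop T] with R hR
  exact hC.le.trans (h.strictMono_length.monotoneOn hT (mem_Ici.2 (le_trans hT hR)) hR)

end IsTurnpikeInterval

namespace ControlProblem

variable {X U Y Z : Type*} [NormedAddCommGroup X] [NormedSpace ℝ X]
  [NormedAddCommGroup U] [InnerProductSpace ℝ U] [CompleteSpace U]
  [NormedAddCommGroup Y] [InnerProductSpace ℝ Y] [CompleteSpace Y]
  [NormedAddCommGroup Z] [NormedSpace ℝ Z]
  (P : ControlProblem X U Y)

/-- The adjoint relations are tested only against `X`; density of `X` in `Y` makes such tests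
determine elements of `Y`. -/
theorem ext_inner_emb {y z : Y} (h : ∀ v : X, ⟪y, P.emb v⟫_ℝ = ⟪z, P.emb v⟫_ℝ) : y = z := by
  refine P.denseRange_emb.eq_of_inner_left ℝ h

/-- The source term of the adjoint equation is small where state and control are near the
steady state and the adjoint is bounded. -/
theorem source_small {k : Z →L[ℝ] Y} {pbar : X × U} (hcont : P.ContinuousRemainders k pbar)
    {σ : ℝ} (hσ : |σ| ≤ 1) (ρ : ℝ) {η : ℝ} (hη : 0 < η) :
    ∀ᶠ p in 𝓝 pbar, ∀ z : Z, ‖z‖ ≤ ρ → ∀ g : Y,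
      (∀ v : X, ⟪g, P.emb v⟫_ℝ = ⟪k z, P.emb (P.fx p v - P.fx pbar v)⟫_ℝ
        - σ * (P.Jx p v - P.Jx pbar v)) → ‖g‖ ≤ η := by
  obtain ⟨R, hRc, hR⟩ := hcont.fx
  obtain ⟨r, hrc, hr⟩ := hcont.Jx
  have hR0 : R pbar = 0 := by
    ext z
    refine P.ext_inner_emb fun v => ?_
    simp [hR]
  have hr0 : r pbar = 0 := by
    refine P.ext_inner_emb fun v => ?_
    simp [hr]
  have hlim : Tendsto (fun p => ‖R p‖ * ρ + ‖r p‖) (𝓝 pbar) (𝓝 0) := by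
    have : Continuous fun p => ‖R p‖ * ρ + ‖r p‖ := by fun_prop
    exact this.tendsto' pbar 0 (by simp [hR0, hr0])
  filter_upwards [hlim.eventually (eventually_le_nhds hη)] with p hp z hz g hg
  have hgeq : g = R p z - σ • r p := by
    refine P.ext_inner_emb fun v => ?_
    rw [hg v, inner_sub_left, real_inner_smul_left, hR, hr]
  calc ‖g‖ ≤ ‖R p z‖ + ‖σ • r p‖ := by rw [hgeq]; exact norm_sub_le _ _
    _ ≤ ‖R p‖ * ρ + 1 * ‖r p‖ := by
      rw [norm_smul]
      exact add_le_add ((R p).le_opNorm_of_le hz)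
        (mul_le_mul_of_nonneg_right hσ (norm_nonneg _))
    _ ≤ η := by rwa [one_mul]

/-- The output `B* (λ - λ̄)` is small where state and control are near the steady state and the
adjoint is bounded. -/
theorem output_small {k : Z →L[ℝ] Y} {σ : ℝ} {pbar : X × U} {lamb : Y}
    (hcont : P.ContinuousRemainders k pbar) (hsteady : P.IsSteadyExtremal σ pbar lamb)
    (ρ : ℝ) {η : ℝ} (hη : 0 < η) :
    ∀ᶠ p in 𝓝 pbar, ∀ l : Y, ‖l‖ ≤ ρ →
      (∀ w : U, ⟪l, P.linB p w⟫_ℝ + P.Ju p w = 0) → ‖P.linBadj pbar (l - lamb)‖ ≤ η := by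
  have hlim : Tendsto (fun p => ρ * ‖P.emb.comp (P.fu p - P.fu pbar)‖ + ‖P.Ju p - P.Ju pbar‖)
      (𝓝 pbar) (𝓝 0) :=
    ((hcont.fu.norm.const_mul ρ).add hcont.Ju.norm).tendsto' pbar 0 (by simp)
  filter_upwards [hlim.eventually (eventually_le_nhds hη)] with p hp l hl hstat
  -- The difference of the stationarity conditions at `p` and `pbar`: the control operator and
  -- `lamb` drop out, and only remainders acting on `l` and on `w` survive.
  have hinner : ∀ w : U, ⟪P.linBadj pbar (l - lamb), w⟫_ℝ
      = -⟪l, P.emb.comp (P.fu p - P.fu pbar) w⟫_ℝ - (P.Ju p - P.Ju pbar) w := fun w => by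
    have h1 := hstat w
    have h2 := hsteady.stationary w
    rw [linBadj, ContinuousLinearMap.adjoint_inner_left, inner_sub_left]
    simp only [linB, ContinuousLinearMap.comp_apply, add_apply, sub_apply, map_add,
      map_sub, inner_add_right, inner_sub_right] at h1 h2 ⊢
    linarith
  set b := P.linBadj pbar (l - lamb)
  refine le_trans ?_ hp
  -- Testing with `w = b` bounds `‖b‖ * ‖b‖`; one factor is cancelled, so `b = 0` is treated apart.
  rcases (norm_nonneg b).eq_or_lt with hb | hb
  · rw [← hb]
    have := (norm_nonneg l).trans hl
    positivity
  · refine le_of_mul_le_mul_right ?_ hb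
    have h1 := abs_le.1 ((abs_real_inner_le_norm l _).trans (mul_le_mul hl
      ((P.emb.comp (P.fu p - P.fu pbar)).le_opNorm b) (norm_nonneg _) ((norm_nonneg l).trans hl)))
    have h2 := abs_le.1 ((P.Ju p - P.Ju pbar).le_opNorm b)
    rw [← real_inner_self_eq_norm_mul_norm, hinner b]
    linarith [h1.1, h2.1]

end ControlProblem

end AdjointTurnpike

/-! ### The turnpike property of the adjoint. -/

theorem mainTheorem1
    {X U Y Z : Type*}
    [NormedAddCommGroup X] [NormedSpace ℝ X] [CompleteSpace X]
    [NormedAddCommGroup U] [InnerProductSpace ℝ U] [CompleteSpace U]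
    [NormedAddCommGroup Y] [InnerProductSpace ℝ Y] [CompleteSpace Y]
    [NormedAddCommGroup Z] [NormedSpace ℝ Z]
    (P : AdjointTurnpike.ControlProblem X U Y)
    -- the sign convention in the adjoint equation
    (σ : ℝ) (hσ : σ = 1 ∨ σ = -1)
    -- the steady state with its adjoint
    (pbar : X × U) (lamb : Y) (hsteady : P.IsSteadyExtremal σ pbar lamb)
    -- `A*` generates a strongly continuous semigroup on `Y`
    (S : ℝ → Y →L[ℝ] Y) (hS : AdjointTurnpike.Generates (P.linAadj pbar) S)
    -- the extremals on the horizons `[0, T]`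
    (x₀ : X) (x : ℝ → ℝ → X) (u : ℝ → ℝ → U) (lam : ℝ → ℝ → Y)
    (hext : ∀ T > 0, P.IsExtremal σ pbar lamb S x₀ T (x T) (u T) (lam T))
    -- interval turnpike for states and controls
    (t₁ t₂ : ℝ → ℝ) (hturn : AdjointTurnpike.StateControlTurnpike t₁ t₂ x u pbar)
    -- continuity of the remainders
    (k : Z →L[ℝ] Y) (hk : Function.Injective k) (hcont : P.ContinuousRemainders k pbar)
    -- uniform boundedness of the adjoints on the turnpike intervals
    (hlamb : lamb ∈ Set.range k)
    (hbound : ∃ ρ : ℝ, ∀ T > 0, ∀ t ∈ Set.Icc (t₁ T) (t₂ T),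
      ∃ z : Z, k z = lam T t - lamb ∧ ‖z‖ ≤ ρ)
    -- finite-dimensional unstable part and exponentially stable stable part of `A*`
    (hsplit : AdjointTurnpike.SpectralSplitting (P.linAadj pbar))
    -- `B*` has finite rank
    (hrank : FiniteDimensional ℝ (LinearMap.range (P.linBadj pbar : Y →ₗ[ℝ] U)))
    -- `(A*, B*)` is exponentially detectable
    (hdetect : AdjointTurnpike.ExpDetectable (P.linAadj pbar) (P.linBadj pbar)) :
    AdjointTurnpike.AdjointTurnpikeProperty lam lamb := by
  obtain ⟨L, V, hV, M, μ, hμ, hVexp⟩ := hdetect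
  obtain ⟨zbar, rfl⟩ := hlamb
  obtain ⟨ρ, hρ⟩ := hbound
  obtain ⟨hint, hturn⟩ := hturn
  have hM : 0 ≤ M := by simpa using (norm_nonneg _).trans (hVexp 0 le_rfl)
  have hρ0 : 0 ≤ ρ := by
    obtain ⟨z, -, hz⟩ := hρ 1 one_pos (t₁ 1) ⟨le_rfl, (hint.bounds 1 zero_le_one).2.1⟩
    exact (norm_nonneg z).trans hz
  refine ⟨t₁, _, hint.left_half, fun ε hε => ?_⟩
  -- the bound `η` for source term and output
  obtain ⟨η, hη, hηε⟩ : ∃ η > 0, M * (η + ‖L‖ * η) / μ ≤ ε / 2 := by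
    -- `M + 1` instead of `M` keeps the denominator positive when `M = 0`.
    refine ⟨ε / 2 * μ / ((M + 1) * (1 + ‖L‖)), by positivity, ?_⟩
    rw [div_le_iff₀ hμ]
    have h1 : M / (M + 1) ≤ 1 := (div_le_one (by linarith)).2 (by linarith)
    calc _ = ε / 2 * μ * (M / (M + 1)) := by field_simp
      _ ≤ ε / 2 * μ * 1 := by gcongr
      _ = ε / 2 * μ := mul_one _
  have hσ1 : |σ| ≤ 1 := by rcases hσ with rfl | rfl <;> simp
  -- On the turnpike interval `λ` is the image under `k` of an element of norm at most `ρ + ‖zbar‖`,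
  -- so its norm in `Y` is at most `‖k‖ * (ρ + ‖zbar‖)`.
  have hnear := (P.source_small hcont hσ1 (ρ + ‖zbar‖) hη).and
    (P.output_small hcont hsteady (‖k‖ * (ρ + ‖zbar‖)) hη)
  obtain ⟨r, hr, hnear⟩ := Metric.eventually_nhds_iff.1 hnear
  obtain ⟨T₀, hT₀, hturn⟩ := hturn (r / 2) (by positivity)
  -- the initial error is forgotten
  have hdecay : Tendsto (fun T => M * Real.exp (-μ * ((t₂ T - t₁ T) / 2)) * (‖k‖ * ρ)) atTop
      (𝓝 0) := by
    have h1 : Tendsto (fun T => μ * ((t₂ T - t₁ T) / 2)) atTop atTop :=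
      (hint.tendsto_length.atTop_div_const two_pos).const_mul_atTop hμ
    have h2 := ((Real.tendsto_exp_neg_atTop_nhds_zero.comp h1).const_mul M).mul_const (‖k‖ * ρ)
    simpa [Function.comp_def] using h2
  obtain ⟨T₁, hT₁⟩ := eventually_atTop.1
    (hdecay.eventually (eventually_le_nhds (half_pos hε)))
  refine ⟨max T₀ T₁, lt_max_of_lt_left hT₀, fun T hT t ht => ?_⟩
  have hTT₀ : T₀ ≤ T := (le_max_left _ _).trans hT
  have hT0 : 0 < T := hT₀.trans_le hTT₀
  obtain ⟨hb1, hb2, hb3⟩ := hint.bounds T hT0.le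
  have hE := hext T hT0
  obtain ⟨g, hg, hgeq, hmild⟩ := hE.adjoint
  have hmildS : AdjointTurnpike.IsBackwardMild S T (fun t => lam T t - k zbar) g := hmild
  -- The equation is restarted at `t₂ T`, since beyond it the source is not controlled, and then
  -- rewritten for the stable semigroup `V`.
  have hmildV := ((hmildS.restrict hS.semigroup hg ⟨hb1.trans hb2, hb3⟩).perturb hS hV
    ((hE.continuous_adjoint.sub continuousOn_const).mono (Icc_subset_Icc_right hb3))
    (hg.mono_set (by
      rw [uIcc_of_le hT0.le, uIcc_of_le (hb1.trans hb2)]; exact Icc_subset_Icc_right hb3)))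
  have htt₂ : t ≤ t₂ T := ht.2.trans (by linarith)
  have hδ : ‖lam T (t₂ T) - k zbar‖ ≤ ‖k‖ * ρ := by
    obtain ⟨z, hz, hzρ⟩ := hρ T hT0 (t₂ T) ⟨hb2, le_rfl⟩
    rw [← hz]
    exact k.le_opNorm_of_le hzρ
  have hsource : ∀ᵐ s, s ∈ Ioc t (t₂ T) →
      ‖g s - (L.comp (P.linBadj pbar)) (lam T s - k zbar)‖ ≤ η + ‖L‖ * η := by
    filter_upwards [(ae_restrict_iff' measurableSet_Icc).1 hgeq,
      (ae_restrict_iff' measurableSet_Icc).1 hE.stationary] with s hs₁ hs₂ hs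
    have hsT : s ∈ Icc 0 T := ⟨(hb1.trans ht.1).trans hs.1.le, hs.2.trans hb3⟩
    have hsI : s ∈ Icc (t₁ T) (t₂ T) := ⟨ht.1.trans hs.1.le, hs.2⟩
    obtain ⟨z, hz, hzρ⟩ := hρ T hT0 s hsI
    have hzk : lam T s = k (z + zbar) := by rw [map_add, hz, sub_add_cancel]
    have hzn : ‖z + zbar‖ ≤ ρ + ‖zbar‖ := (norm_add_le _ _).trans (by gcongr)
    have hdist : dist (x T s, u T s) pbar < r := by
      have h1 := hturn T hTT₀ s hsI
      have h2 := norm_nonneg (x T s - pbar.1)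
      have h3 := norm_nonneg (u T s - pbar.2)
      rw [Prod.dist_eq, dist_eq_norm, dist_eq_norm]
      exact max_lt (by linarith) (by linarith)
    obtain ⟨h1, h2⟩ := hnear hdist
    have h3 := h1 (z + zbar) hzn (g s) (by rw [← hzk]; exact hs₁ hsT)
    have h4 := h2 (lam T s) (by rw [hzk]; exact k.le_opNorm_of_le hzn) (hs₂ hsT)
    exact (norm_sub_le _ _).trans (add_le_add h3 (L.le_opNorm_of_le h4))
  have hfinal : ‖lam T t - k zbar‖ ≤ M * Real.exp (-μ * (t₂ T - t)) * ‖lam T (t₂ T) - k zbar‖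
      + M * (η + ‖L‖ * η) / μ := hmildV.norm_le hμ hVexp ⟨hb1.trans ht.1, htt₂⟩ hsource (by positivity)
  have hexp : M * Real.exp (-μ * (t₂ T - t)) * ‖lam T (t₂ T) - k zbar‖
      ≤ M * Real.exp (-μ * ((t₂ T - t₁ T) / 2)) * (‖k‖ * ρ) := by
    -- To the left of the midpoint, the distance to `t₂ T` is at least half the length of the
    -- interval.
    have h1 : -μ * (t₂ T - t) ≤ -μ * ((t₂ T - t₁ T) / 2) := by
      have := ht.2
      nlinarith
    gcongr
  have h5 := hT₁ T ((le_max_right _ _).trans hT)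
  linarith
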